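/- **Proposition G (linear case).** Let $d,l\ge 0$ and $r\ge 1$ be integers and let $P=\{p_{ij}\colon\mathbb{Z}^d\to\mathbb{Z} : 1\le i\le r,\ 1\le j\le l\}$ be a family of linear functions, i.e. $p_{ij}(u)=\sum_{k=1}^d a_{ijk}u_k+c_{ij}$ with $a_{ijk},c_{ij}\in\mathbb{Z}$. Assume that $P$ is an ED-set: (1) no $p_{ij}$ is equal to a nonzero constant; (2) no two members of $P$ differ by a nonzero constant; (3) for each $i$ there is $j$ with $p_{ij}\ne 0$; (4) for all $i_1\neq i_2$ there is $j$ with $p_{i_1j}\ne p_{i_2j}$. Then there is a constant $C>0$, depending only on $P$, with the following property. Let $(X,\mathcal{B},\mu,(T_1,\dots,T_l))$ be any freely generated totally ergodic system, i.e. $(X,\mathcal B,\mu)$ is a probability space, $T_1,\dots,T_l$ are commuting invertible (bi-measurable) measure preserving transformations of it, and $T_1^{c_1}\cdots T_l^{c_l}$ is ergodic for every $(c_1,\dots,c_l)\in\mathbb{Z}^l\setminus\{0\}$. Let $T$ be any one of $T_1,\dots,T_l$. Put $\mu_T^{[0]}=\mu$ on $X^{[0]}=X$ and let $\mu_T^{[k+1]}$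 be the relatively independent square of $\mu_T^{[k]}$ over the $\sigma$-algebra $\mathcal I_T^{[k]}$ of $T\times\dots\times T$-invariant sets in $X^{[k]}=X^{2^k}$, i.e. the probability measure on $X^{[k+1]}=X^{[k]}\times X^{[k]}$ with $$\int F(x')G(x'')\,d\mu_T^{[k+1]}(x',x'')=\int \mathbb{E}(F|\mathcal I_T^{[k]})\,\mathbb{E}(G|\mathcal I_T^{[k]})\,d\mu_T^{[k]}\qquad(F,G\in L^\infty(\mu_T^{[k]})).$$ Assume that $\mu_T^{[r+1]}$ (hence every $\mu_T^{[k]}$ with $k\le r+1$) exists, which is automatic when $X$ is a standard Borel space; these measures are unique. Let $$|||f|||_{k}=\Big(\int \prod_{j=0}^{2^k-1}f(x_j)\,d\mu_T^{[k]}(x)\Big)^{1/2^k}\qquad(k\ge1).$$ Then for all real-valued $f_1,\dots,f_r\in L^\infty(\mu)$ with $\|f_i\|_{L^\infty(\mu)}\le 1$ and every Følner sequence $\{\Phi_N\}$ of finite subsets of $\mathbb{Z}^d$, $$\limsup_{N\to\infty}\Big\|\frac1{|\Phi_N|}\sum_{u\in\Phi_N}\prod_{i=1}^r f_i\big(T_1^{p_{i1}(u)}\cdots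 T_l^{p_{il}(u)}x\big)\Big\|_{L^2(\mu)}\le C\,\min_{1\le i\le r}|||f_i|||_{r+1}.$$ -/

import Mathlib

open MeasureTheory ProbabilityTheory Filter
open scoped ENNReal

universe u

noncomputable section

section Systems

variable {X : Type u} [MeasurableSpace X] {l : ℕ}

/-- The transformation `T₁ ^ c₁ ∘ T₂ ^ c₂ ∘ ⋯ ∘ T_l ^ c_l` of `X` (composition is the product of
`Equiv.Perm X`; exponents are integers). -/
def genPow (T : Fin l → X ≃ᵐ X) (c : Fin l → ℤ) : Equiv.Perm X :=
  (List.ofFn fun j => ((T j).toEquiv : Equiv.Perm X) ^ (c j)).prod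

/-- `(X, μ, (T₁, …, T_l))` is a freely generated totally ergodic system: the `T_j` are commuting
invertible measure preserving transformations, and every `T₁ ^ c₁ ⋯ T_l ^ c_l` with
`(c₁, …, c_l) ≠ 0` is ergodic. -/
structure IsFreelyGeneratedTotallyErgodic (μ : Measure X) (T : Fin l → X ≃ᵐ X) : Prop where
  measurePreserving : ∀ j, MeasurePreserving (T j) μ μ
  commute : ∀ i j x, T i (T j x) = T j (T i x)
  ergodic : ∀ c : Fin l → ℤ, c ≠ 0 → Ergodic (genPow T c) μ

/-- The average `|Φ|⁻¹ ∑_{u ∈ Φ} ∏_i f_i (T₁ ^ p_{i1}(u) ⋯ T_l ^ p_{il}(u) x)`. -/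
def multiAverage {d r : ℕ} (T : Fin l → X ≃ᵐ X) (p : Fin r → Fin l → (Fin d → ℤ) → ℤ)
    (f : Fin r → X → ℝ) (Φ : Finset (Fin d → ℤ)) (x : X) : ℝ :=
  (Φ.card : ℝ)⁻¹ * ∑ u ∈ Φ, ∏ i, f i (genPow T (fun j => p i j u) x)

end Systems

section Families

variable {d l r : ℕ}

/-- A linear function `ℤ^d → ℤ`: an integer polynomial function of degree at most one. -/
def IsLinearFunction (q : (Fin d → ℤ) → ℤ) : Prop :=
  ∃ (a : Fin d → ℤ) (c : ℤ), ∀ u, q u = ∑ k, a k * u k + c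

/-- The four defining conditions of an ED-set `{p_{ij}}`. -/
structure IsEDSet (p : Fin r → Fin l → (Fin d → ℤ) → ℤ) : Prop where
  not_const : ∀ i j (c : ℤ), c ≠ 0 → p i j ≠ fun _ => c
  not_differ_const : ∀ i₁ j₁ i₂ j₂ (c : ℤ), c ≠ 0 → p i₁ j₁ - p i₂ j₂ ≠ fun _ => c
  row_ne_zero : ∀ i, ∃ j, p i j ≠ 0
  rows_distinct : ∀ i₁ i₂, i₁ ≠ i₂ → ∃ j, p i₁ j ≠ p i₂ j

end Families

section HostKra

/-- The cube `X^[k] = X^(2^k)`, with `X^[k+1] = X^[k] × X^[k]`. -/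
def Cube (X : Type u) : ℕ → Type u
  | 0 => X
  | k + 1 => Cube X k × Cube X k

/-- The product σ-algebra on `X^[k]`. -/
instance Cube.instMeasurableSpace (X : Type u) [m : MeasurableSpace X] :
    (k : ℕ) → MeasurableSpace (Cube X k)
  | 0 => m
  | k + 1 => @Prod.instMeasurableSpace _ _ (Cube.instMeasurableSpace X k)
      (Cube.instMeasurableSpace X k)

/-- The diagonal transformation `T^[k] = T × ⋯ × T` of `X^[k]`. -/
def cubeMap {X : Type u} (T : X → X) : (k : ℕ) → Cube X k → Cube X k
  | 0 => T
  | k + 1 => fun x => (cubeMap T k x.1, cubeMap T k x.2)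

/-- The function `x ↦ ∏_j f (x_j)` on `X^[k]`. -/
def cubeProd {X : Type u} (f : X → ℝ) : (k : ℕ) → Cube X k → ℝ
  | 0 => f
  | k + 1 => fun x => cubeProd f k x.1 * cubeProd f k x.2

/-- `ρ` is the relatively independent square `ν ×_I ν` of `ν` over the sub-σ-algebra `I`. -/
def IsRelIndepSquare {Y : Type u} (I : MeasurableSpace Y) [mY : MeasurableSpace Y]
    (ν : Measure[mY] Y) (ρ : Measure[mY.prod mY] (Y × Y)) : Prop :=
  IsProbabilityMeasure ρ ∧ ∀ F G : Y → ℝ, MemLp F ∞ ν → MemLp G ∞ ν →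
    ∫ z, F z.1 * G z.2 ∂ρ = ∫ y, (ν[F | I]) y * (ν[G | I]) y ∂ν

variable {X : Type u} [MeasurableSpace X]

/-- `ν` is the Host-Kra measure `μ^[k]_T`: `μ^[0]_T = μ`, and `μ^[k+1]_T` is the relatively
independent square of `μ^[k]_T` over the σ-algebra of `T^[k]`-invariant sets. -/
def IsHostKraMeasure (T : X → X) (μ : Measure X) : (k : ℕ) → Measure (Cube X k) → Prop
  | 0, ν => ν = μ
  | k + 1, ρ => ∃ ν : Measure (Cube X k), IsHostKraMeasure T μ k ν ∧
      IsRelIndepSquare (MeasurableSpace.invariants (cubeMap T k)) ν ρ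

/-- The measure `μ^[k]_T` exists. On a standard Borel space it always does
(`hasHostKraMeasure_of_standardBorel`); on an arbitrary probability space the relatively
independent squares need not be countably additive. -/
def HasHostKraMeasure (T : X → X) (μ : Measure X) (k : ℕ) : Prop :=
  ∃ ν, IsHostKraMeasure T μ k ν

open Classical in
/-- The measure `μ^[k]_T` (`0` if it does not exist); it is unique by
`IsHostKraMeasure.unique`. -/
def hostKraMeasure (T : X → X) (μ : Measure X) (k : ℕ) : Measure (Cube X k) :=
  if h : HasHostKraMeasure T μ k then h.choose else 0

/-- The Host-Kra seminorm `|||f|||_{k,T} = (∫ ∏_j f (x_j) dμ^[k]_T) ^ (1 / 2^k)`, for `k ≥ 1`. -/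
def hostKraSeminorm (T : X → X) (μ : Measure X) (k : ℕ) (f : X → ℝ) : ℝ :=
  (∫ x, cubeProd f k x ∂(hostKraMeasure T μ k)) ^ (1 / (2 : ℝ) ^ k)

lemma isHostKraMeasure_hostKraMeasure {T : X → X} {μ : Measure X} {k : ℕ}
    (h : HasHostKraMeasure T μ k) : IsHostKraMeasure T μ k (hostKraMeasure T μ k) := by
  rw [hostKraMeasure, dif_pos h]
  exact h.choose_spec

lemma isProbabilityMeasure_of_isHostKraMeasure {T : X → X} {μ : Measure X}
    [IsProbabilityMeasure μ] {k : ℕ} {ν : Measure (Cube X k)} (h : IsHostKraMeasure T μ k ν) :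
    IsProbabilityMeasure ν := by
  cases k with
  | zero =>
    have h' : ν = μ := h
    exact h' ▸ ‹IsProbabilityMeasure μ›
  | succ k =>
    obtain ⟨_, _, h2⟩ := h
    exact h2.1

lemma IsRelIndepSquare.unique {Y : Type u} {I : MeasurableSpace Y} [mY : MeasurableSpace Y]
    {ν : Measure Y} [IsProbabilityMeasure ν] {ρ ρ' : Measure (Y × Y)}
    (h : IsRelIndepSquare I ν ρ) (h' : IsRelIndepSquare I ν ρ') : ρ = ρ' := by
  have := h.1
  have := h'.1
  have key : ∀ {s t : Set Y}, MeasurableSet s → MeasurableSet t → ρ (s ×ˢ t) = ρ' (s ×ˢ t) := by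
    intro s t hs ht
    have mem : ∀ {s : Set Y}, MeasurableSet s → MemLp (s.indicator (1 : Y → ℝ)) ∞ ν :=
      fun hs => (memLp_const (1 : ℝ)).indicator hs
    have e := (h.2 _ _ (mem hs) (mem ht)).trans (h'.2 _ _ (mem hs) (mem ht)).symm
    have r : (fun z : Y × Y => s.indicator (1 : Y → ℝ) z.1 * t.indicator (1 : Y → ℝ) z.2)
        = (s ×ˢ t).indicator 1 := by
      ext z
      by_cases h1 : z.1 ∈ s <;> by_cases h2 : z.2 ∈ t <;> simp [Set.indicator, h1, h2]
    rw [r, integral_indicator_one (hs.prod ht), integral_indicator_one (hs.prod ht)] at e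
    exact (measureReal_eq_measureReal_iff).1 e
  exact Measure.ext_prod key

/-- The Host-Kra measure is unique. -/
theorem IsHostKraMeasure.unique {T : X → X} {μ : Measure X} [IsProbabilityMeasure μ] {k : ℕ}
    {ν ν' : Measure (Cube X k)} (h : IsHostKraMeasure T μ k ν) (h' : IsHostKraMeasure T μ k ν') :
    ν = ν' := by
  induction k with
  | zero => exact Eq.trans h (Eq.symm h')
  | succ k ih =>
    obtain ⟨ν₁, h1, h2⟩ := h
    obtain ⟨ν₂, h3, h4⟩ := h'
    obtain rfl := ih h1 h3
    have := isProbabilityMeasure_of_isHostKraMeasure h1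
    exact h2.unique h4

theorem exists_isRelIndepSquare {Y : Type u} {I : MeasurableSpace Y} [mY : MeasurableSpace Y]
    [StandardBorelSpace Y] (ν : Measure Y) [IsProbabilityMeasure ν] (hI : I ≤ mY) :
    ∃ ρ, IsRelIndepSquare I ν ρ := by
  let κ : Kernel Y Y := (condExpKernel ν I).comap id (measurable_id'' hI)
  have hκ : ∀ y, κ y = condExpKernel ν I y := fun y => rfl
  have hbind : κ ∘ₘ ν = ν := by
    conv_rhs => rw [← condExpKernel_comp_trim (μ := ν) hI]
    ext s hs
    rw [Measure.bind_apply hs κ.aemeasurable, Measure.bind_apply hs (Kernel.aemeasurable _),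
      lintegral_trim hI ((condExpKernel ν I).measurable_coe hs)]
    rfl
  have hfst : ((κ ×ₖ κ) ∘ₘ ν).map Prod.fst = ν := by
    rw [Measure.map_comp _ _ measurable_fst, ← Kernel.fst_eq, Kernel.fst_prod, hbind]
  have hsnd : ((κ ×ₖ κ) ∘ₘ ν).map Prod.snd = ν := by
    rw [Measure.map_comp _ _ measurable_snd, ← Kernel.snd_eq, Kernel.snd_prod, hbind]
  have mp1 : MeasurePreserving Prod.fst ((κ ×ₖ κ) ∘ₘ ν) ν := ⟨measurable_fst, hfst⟩
  have mp2 : MeasurePreserving Prod.snd ((κ ×ₖ κ) ∘ₘ ν) ν := ⟨measurable_snd, hsnd⟩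
  refine ⟨(κ ×ₖ κ) ∘ₘ ν, inferInstance, fun F G hF hG => ?_⟩
  have hint : Integrable (fun z : Y × Y => F z.1 * G z.2) ((κ ×ₖ κ) ∘ₘ ν) :=
    memLp_one_iff_integrable.1
      (((hG.comp_measurePreserving mp2).mono_exponent le_top).mul
        (hF.comp_measurePreserving mp1) (p := ∞) (q := 1) (r := 1))
  rw [Measure.comp_eq_comp_const_apply] at hint ⊢
  rw [Kernel.integral_comp hint, Kernel.const_apply]
  have e1 := condExp_ae_eq_integral_condExpKernel hI (hF.integrable le_top)
  have e2 := condExp_ae_eq_integral_condExpKernel hI (hG.integrable le_top)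
  refine integral_congr_ae ?_
  filter_upwards [e1, e2] with y h1 h2
  rw [h1, h2, Kernel.prod_apply, integral_prod_mul, hκ]

instance Cube.instStandardBorelSpace [StandardBorelSpace X] :
    (k : ℕ) → StandardBorelSpace (Cube X k)
  | 0 => ‹StandardBorelSpace X›
  | k + 1 => @StandardBorelSpace.prod _ _ _ _ (Cube.instStandardBorelSpace k)
      (Cube.instStandardBorelSpace k)

/-- On a standard Borel probability space all the Host-Kra measures exist. -/
theorem hasHostKraMeasure_of_standardBorel [StandardBorelSpace X] (T : X → X)
    (μ : Measure X) [IsProbabilityMeasure μ] (k : ℕ) : HasHostKraMeasure T μ k := by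
  induction k with
  | zero => exact ⟨μ, rfl⟩
  | succ k ih =>
    obtain ⟨ν, hν⟩ := ih
    have := isProbabilityMeasure_of_isHostKraMeasure hν
    obtain ⟨ρ, hρ⟩ := exists_isRelIndepSquare ν
      (MeasurableSpace.invariants_le (cubeMap T k))
    exact ⟨ρ, ν, hν, hρ⟩

end HostKra

end

/-! The constant is `C = 1`, and the seminorm of order `r` already bounds the averages; Jensen's
inequality (`cubeIntegral_sq_le`) then passes to order `r + 1`. Write each row as `c i + A i u` with
`A i : ℤ^d → ℤ^l` additive. The ED conditions make the `A i` nonzero and pairwise distinct, and the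
constants `c i` are absorbed into the functions, which leaves the cube integrals unchanged
(`cubeIntegral_comp`).

The averages are bounded by a linear induction of van der Corput type that alternates two
statements. A correlation of `k + 1` functions along distinct `A i` becomes, after one of them is
moved to time zero and Cauchy-Schwarz is applied, the norm of an average of `k` functions along the
differences `A i - A i₁`. The norm of an average, squared by van der Corput along multiples of some
`e` with `A i₀ e ≠ 0`, becomes a mean of correlations of the products `f i ∘ S_i^m * f i ∘ S_i^n`,
where `S_i` is translation by `A i e`. This raises the order of the seminorm by one.

The last point needs the mean of the order `k` integrals of `f ∘ S^m * f ∘ S^n` to be at most the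
order `k + 1` integral of `f` for `T`, although `S` is not `T`. This is
`eventually_pairAvg_cubeIntegral_le`, where total ergodicity enters: `S` is ergodic and commutes
with `T`. Its proof exchanges averages along `S` and `T`. The `T`-averages converge to the next cube
integral and, for each finite length, are at least as large as it, so no uniformity is needed.
Averaging over pairs `(m, n)` rather than over differences makes each such mean exactly the squared
norm of a Birkhoff average. -/

/-- The average of `a m n` over `m, n < M`. -/
noncomputable def pairAvg (a : ℕ → ℕ → ℝ) (M : ℕ) : ℝ :=
  ((M : ℝ) ^ 2)⁻¹ * ∑ m ∈ Finset.range M, ∑ n ∈ Finset.range M, a m n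

/-! ### The mean ergodic theorem as a statement on correlations. -/

section MeanErgodic

variable {Y : Type*} [MeasurableSpace Y] {ν : Measure Y} {τ : Y → Y}

lemma ae_comp_iterate_eq (hτ : MeasurePreserving τ ν ν) {v : Y → ℝ} (h : v ∘ τ =ᵐ[ν] v) (n : ℕ) :
    v ∘ τ^[n] =ᵐ[ν] v := by
  induction n with
  | zero => rfl
  | succ n ih =>
    have h1 : (v ∘ τ^[n]) ∘ τ =ᵐ[ν] v ∘ τ := ih.comp_tendsto hτ.quasiMeasurePreserving.tendsto_ae
    rw [Function.iterate_succ, ← Function.comp_assoc]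
    exact h1.trans h

/-- The limsup of a measurable version along the orbit does not see its first term, hence is
strictly invariant; almost everywhere the orbit values are constant, so it agrees with `v`. -/
lemma exists_measurable_invariants_ae_eq (hτ : MeasurePreserving τ ν ν) {v : Y → ℝ}
    (hv : AEStronglyMeasurable v ν) (h : v ∘ τ =ᵐ[ν] v) :
    ∃ w : Y → ℝ, Measurable[MeasurableSpace.invariants τ] w ∧ w =ᵐ[ν] v := by
  set v' := hv.mk v with hv'
  have hm : Measurable v' := hv.stronglyMeasurable_mk.measurable
  have e : v' =ᵐ[ν] v := hv.ae_eq_mk.symm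
  have h' : v' ∘ τ =ᵐ[ν] v' :=
    ((e.comp_tendsto hτ.quasiMeasurePreserving.tendsto_ae).trans h).trans e.symm
  refine ⟨fun x => limsup (fun n => v' (τ^[n] x)) atTop, ?_, ?_⟩
  · rw [MeasurableSpace.measurable_invariants_dom]
    refine ⟨Measurable.limsup fun n => hm.comp (hτ.measurable.iterate n), fun s _ => ?_⟩
    congr 1
    ext x
    have := Filter.limsup_nat_add (fun n => v' (τ^[n] x)) 1
    simpa [Function.iterate_succ_apply] using this
  · have h2 : ∀ᵐ x ∂ν, ∀ n, v' (τ^[n] x) = v' x := ae_all_iff.2 fun n => ae_comp_iterate_eq hτ h' n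
    filter_upwards [h2, e] with x hx hx'
    simp [hx, hx']

/-- The Koopman operator on `L²`. -/
noncomputable def koopman (hτ : MeasurePreserving τ ν ν) : Lp ℝ 2 ν →L[ℝ] Lp ℝ 2 ν :=
  (Lp.compMeasurePreservingₗᵢ ℝ τ hτ).toContinuousLinearMap

lemma koopman_toLp (hτ : MeasurePreserving τ ν ν) {F : Y → ℝ} (hF : MemLp F 2 ν) :
    koopman hτ (hF.toLp F) = (hF.comp_measurePreserving hτ).toLp _ := rfl

lemma norm_koopman_apply (hτ : MeasurePreserving τ ν ν) (x : Lp ℝ 2 ν) : ‖koopman hτ x‖ = ‖x‖ :=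
  (Lp.compMeasurePreservingₗᵢ ℝ τ hτ).norm_map x

lemma inner_koopman (hτ : MeasurePreserving τ ν ν) (x y : Lp ℝ 2 ν) :
    inner ℝ (koopman hτ x) (koopman hτ y) = inner ℝ x y :=
  (Lp.compMeasurePreservingₗᵢ ℝ τ hτ).inner_map_map x y

lemma koopman_iterate_toLp (hτ : MeasurePreserving τ ν ν) {F : Y → ℝ} (hF : MemLp F 2 ν) (n : ℕ) :
    (koopman hτ)^[n] (hF.toLp F) = (hF.comp_measurePreserving (hτ.iterate n)).toLp _ := by
  induction n with
  | zero => rfl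
  | succ n ih =>
    rw [Function.iterate_succ_apply', ih, koopman_toLp]
    rfl

lemma inner_toLp {F G : Y → ℝ} (hF : MemLp F 2 ν) (hG : MemLp G 2 ν) :
    inner ℝ (hF.toLp F) (hG.toLp G) = ∫ y, F y * G y ∂ν := by
  rw [L2.inner_def]
  refine integral_congr_ae ?_
  filter_upwards [hF.coeFn_toLp, hG.coeFn_toLp] with y h1 h2
  rw [h1, h2]
  simp [mul_comm]

lemma norm_birkhoffAverage_sq (hτ : MeasurePreserving τ ν ν) {F : Y → ℝ} (hF : MemLp F 2 ν)
    (M : ℕ) : ‖birkhoffAverage ℝ (koopman hτ) _root_.id M (hF.toLp F)‖ ^ 2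
      = pairAvg (fun m n => ∫ y, F (τ^[m] y) * F (τ^[n] y) ∂ν) M := by
  rw [← real_inner_self_eq_norm_sq, birkhoffAverage, birkhoffSum, real_inner_smul_left,
    real_inner_smul_right, sum_inner, pairAvg, ← mul_assoc]
  congr 1
  · rw [sq, mul_inv]
  · refine Finset.sum_congr rfl fun m _ => ?_
    rw [inner_sum]
    refine Finset.sum_congr rfl fun n _ => ?_
    rw [id, id, koopman_iterate_toLp, koopman_iterate_toLp, inner_toLp]
    rfl

lemma memLp_two_condExp {F : Y → ℝ} (hF : MemLp F 2 ν) (I : MeasurableSpace Y) :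
    MemLp (ν[F | I]) 2 ν := hF.condExp (by norm_num)

variable [IsProbabilityMeasure ν]

/-- Fixed vectors of the Koopman operator are the classes of functions measurable for the invariant
σ-algebra, and the residual of the conditional expectation is orthogonal to these by the pull-out
property. -/
lemma orthogonalProjection_toLp_eq (hτ : MeasurePreserving τ ν ν) {F : Y → ℝ} (hF : MemLp F 2 ν) :
    (((koopman hτ).eqLocus (1 : Lp ℝ 2 ν →L[ℝ] Lp ℝ 2 ν)).orthogonalProjectionOnto
      (hF.toLp F) : Lp ℝ 2 ν)
      = (memLp_two_condExp hF (MeasurableSpace.invariants τ)).toLp _ := by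
  have hI := MeasurableSpace.invariants_le τ
  refine Submodule.eq_starProjection_of_mem_of_inner_eq_zero ?_ ?_
  · change koopman hτ _ = _
    rw [koopman_toLp]
    congr 1
    exact MeasurableSpace.comp_eq_of_measurable_invariants
      (stronglyMeasurable_condExp (μ := ν) (f := F)).measurable
  · intro v hv
    have hv' : koopman hτ v = v := hv
    have hfix : (v : Y → ℝ) ∘ τ =ᵐ[ν] v := by
      have := Lp.coeFn_compMeasurePreserving v hτ
      have e : Lp.compMeasurePreserving τ hτ v = v := hv'
      rw [e] at this
      exact this.symm
    obtain ⟨w, hw, hwv⟩ := exists_measurable_invariants_ae_eq hτ (Lp.aestronglyMeasurable v) hfix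
    have hwL : MemLp w 2 ν := (memLp_congr_ae hwv).2 (Lp.memLp v)
    have e : v = hwL.toLp w := by
      rw [← Lp.toLp_coeFn v (Lp.memLp v)]
      exact (MemLp.toLp_eq_toLp_iff _ _).2 hwv.symm
    have hint : Integrable (w * F) ν := hwL.integrable_mul hF
    have h1 := condExp_mul_of_stronglyMeasurable_left hw.stronglyMeasurable hint
      (hF.integrable (by norm_num))
    rw [e, inner_sub_left, inner_toLp, inner_toLp, sub_eq_zero]
    calc ∫ y, F y * w y ∂ν = ∫ y, (w * F) y ∂ν := by simp [mul_comm]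
      _ = ∫ y, (ν[w * F | MeasurableSpace.invariants τ]) y ∂ν := (integral_condExp hI).symm
      _ = _ := integral_congr_ae (by filter_upwards [h1] with y hy; rw [hy]; simp [mul_comm])

lemma norm_orthogonalProjection_sq (hτ : MeasurePreserving τ ν ν) {F : Y → ℝ} (hF : MemLp F 2 ν) :
    ‖(((koopman hτ).eqLocus (1 : Lp ℝ 2 ν →L[ℝ] Lp ℝ 2 ν)).orthogonalProjectionOnto
      (hF.toLp F) : Lp ℝ 2 ν)‖ ^ 2
      = ∫ y, (ν[F | MeasurableSpace.invariants τ]) y * (ν[F | MeasurableSpace.invariants τ]) y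
        ∂ν := by
  rw [orthogonalProjection_toLp_eq, ← real_inner_self_eq_norm_sq, inner_toLp]

/-- The **mean ergodic theorem** in terms of correlations. -/
theorem tendsto_pairAvg_integral (hτ : MeasurePreserving τ ν ν) {F : Y → ℝ} (hF : MemLp F 2 ν) :
    Tendsto (pairAvg fun m n => ∫ y, F (τ^[m] y) * F (τ^[n] y) ∂ν) atTop
      (nhds (∫ y, (ν[F | MeasurableSpace.invariants τ]) y
        * (ν[F | MeasurableSpace.invariants τ]) y ∂ν)) := by
  rw [← norm_orthogonalProjection_sq hτ hF]
  rw [show (pairAvg fun m n => ∫ y, F (τ^[m] y) * F (τ^[n] y) ∂ν) = fun M =>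
    ‖birkhoffAverage ℝ (koopman hτ) _root_.id M (hF.toLp F)‖ ^ 2 from
    funext fun M => (norm_birkhoffAverage_sq hτ hF M).symm]
  refine ((ContinuousLinearMap.tendsto_birkhoffAverage_orthogonalProjection (koopman hτ) ?_
    (hF.toLp F)).norm.pow 2)
  exact ContinuousLinearMap.opNorm_le_bound _ zero_le_one fun x => by
    rw [norm_koopman_apply, one_mul]

/-- All Birkhoff averages of `F` have the same projection to the fixed space, and projections
contract. The bound therefore holds at every finite length, not only in the limit. -/
theorem integral_condExp_sq_le_pairAvg (hτ : MeasurePreserving τ ν ν) {F : Y → ℝ}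
    (hF : MemLp F 2 ν) {M : ℕ} (hM : 0 < M) :
    ∫ y, (ν[F | MeasurableSpace.invariants τ]) y * (ν[F | MeasurableSpace.invariants τ]) y ∂ν
      ≤ pairAvg (fun m n => ∫ y, F (τ^[m] y) * F (τ^[n] y) ∂ν) M := by
  rw [← norm_orthogonalProjection_sq hτ hF, ← norm_birkhoffAverage_sq hτ hF]
  set V := (koopman hτ).eqLocus (1 : Lp ℝ 2 ν →L[ℝ] Lp ℝ 2 ν)
  set P := V.orthogonalProjectionOnto
  -- For a fixed vector `v` the isometry gives `⟨v, Ux⟩ = ⟨Uv, Ux⟩ = ⟨v, x⟩`, so `Ux - x` is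
  -- orthogonal to the fixed space.
  have hU : ∀ x, P (koopman hτ x) = P x := by
    intro x
    rw [← sub_eq_zero, ← map_sub]
    refine Submodule.orthogonalProjectionOnto_apply_of_mem_orthogonal fun v hv => ?_
    have hv' : koopman hτ v = v := hv
    rw [inner_sub_right]
    nth_rw 1 [← hv']
    rw [inner_koopman, sub_self]
  have hUn : ∀ (n : ℕ) x, P ((koopman hτ)^[n] x) = P x := by
    intro n
    induction n with
    | zero => intro x; rfl
    | succ n ih => intro x; rw [Function.iterate_succ_apply, ih, hU]
  have hP : P (birkhoffAverage ℝ (koopman hτ) _root_.id M (hF.toLp F)) = P (hF.toLp F) := by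
    rw [birkhoffAverage, birkhoffSum, map_smul, map_sum]
    simp only [id, hUn, Finset.sum_const, Finset.card_range]
    rw [← Nat.cast_smul_eq_nsmul ℝ, smul_smul, inv_mul_cancel₀ (by positivity), one_smul]
  rw [← hP]
  gcongr
  exact V.norm_orthogonalProjectionOnto_apply_le _

/-- For an ergodic map the correlations of a function average out to the square of its
integral. -/
theorem tendsto_pairAvg_integral_of_ergodic (hτ : Ergodic τ ν) {F : Y → ℝ} (hF : MemLp F 2 ν) :
    Tendsto (pairAvg fun m n => ∫ y, F (τ^[m] y) * F (τ^[n] y) ∂ν) atTop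
      (nhds ((∫ y, F y ∂ν) ^ 2)) := by
  have hI := MeasurableSpace.invariants_le τ
  have h := tendsto_pairAvg_integral hτ.toMeasurePreserving hF
  have hm : Measurable[MeasurableSpace.invariants τ] (ν[F | MeasurableSpace.invariants τ]) :=
    stronglyMeasurable_condExp.measurable
  obtain ⟨c, hc⟩ := hτ.ae_eq_const_of_ae_eq_comp_ae
    (stronglyMeasurable_condExp.mono hI).aestronglyMeasurable
    (Filter.EventuallyEq.of_eq (MeasurableSpace.comp_eq_of_measurable_invariants hm))
  have e1 : ∫ y, F y ∂ν = c := by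
    rw [← integral_condExp hI, integral_congr_ae hc]
    simp
  have e2 : ∫ y, (ν[F | MeasurableSpace.invariants τ]) y
        * (ν[F | MeasurableSpace.invariants τ]) y ∂ν = c ^ 2 := by
    rw [integral_congr_ae (g := fun _ => c * c)]
    · simp [sq]
    · filter_upwards [hc] with y hy
      rw [hy, Function.const_apply]
  rwa [e2, ← e1] at h

end MeanErgodic

/-! ### Marginals and invariance of relatively independent squares. -/

section RelIndepSquare

variable {Y : Type u} {I : MeasurableSpace Y} [mY : MeasurableSpace Y] {ν : Measure Y}
  [IsProbabilityMeasure ν] {ρ : Measure (Y × Y)}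

lemma IsRelIndepSquare.measurePreserving_fst (hI : I ≤ mY) (h : IsRelIndepSquare I ν ρ) :
    MeasurePreserving Prod.fst ρ ν := by
  have := h.1
  refine ⟨measurable_fst, ?_⟩
  ext s hs
  have hF : MemLp (s.indicator (1 : Y → ℝ)) ∞ ν := (memLp_const (1 : ℝ)).indicator hs
  have e := h.2 _ _ hF (memLp_const (1 : ℝ))
  rw [condExp_const hI] at e
  simp only [mul_one] at e
  rw [integral_condExp hI, integral_indicator_one hs] at e
  have r : (fun z : Y × Y => s.indicator (1 : Y → ℝ) z.1) = (Prod.fst ⁻¹' s).indicator 1 := rfl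
  rw [r, integral_indicator_one (measurable_fst hs)] at e
  rw [Measure.map_apply measurable_fst hs]
  exact (measureReal_eq_measureReal_iff).1 e

lemma IsRelIndepSquare.measurePreserving_snd (hI : I ≤ mY) (h : IsRelIndepSquare I ν ρ) :
    MeasurePreserving Prod.snd ρ ν := by
  have := h.1
  refine ⟨measurable_snd, ?_⟩
  ext s hs
  have hF : MemLp (s.indicator (1 : Y → ℝ)) ∞ ν := (memLp_const (1 : ℝ)).indicator hs
  have e := h.2 _ _ (memLp_const (1 : ℝ)) hF
  rw [condExp_const hI] at e
  simp only [one_mul] at e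
  rw [integral_condExp hI, integral_indicator_one hs] at e
  have r : (fun z : Y × Y => s.indicator (1 : Y → ℝ) z.2) = (Prod.snd ⁻¹' s).indicator 1 := rfl
  rw [r, integral_indicator_one (measurable_snd hs)] at e
  rw [Measure.map_apply measurable_snd hs]
  exact (measureReal_eq_measureReal_iff).1 e

lemma condExp_invariants_comp_ae_eq {τ : Y → Y} (hτ : MeasurePreserving τ ν ν) {F : Y → ℝ}
    (hF : Integrable F ν) :
    ν[F ∘ τ | MeasurableSpace.invariants τ] =ᵐ[ν] ν[F | MeasurableSpace.invariants τ] := by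
  have hI := MeasurableSpace.invariants_le τ
  refine (ae_eq_condExp_of_forall_setIntegral_eq hI (hτ.integrable_comp_of_integrable hF)
    (fun s _ _ => integrable_condExp.integrableOn) (fun s hs _ => ?_)
    stronglyMeasurable_condExp.aestronglyMeasurable).symm
  have hs' : MeasurableSet s := hs.1
  rw [setIntegral_condExp hI hF hs, ← integral_indicator hs', ← integral_indicator hs']
  nth_rw 1 [← hτ.map_eq]
  rw [integral_map hτ.measurable.aemeasurable]
  · congr 1
    ext y
    have : τ y ∈ s ↔ y ∈ s := by
      conv_rhs => rw [← hs.2]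
      rfl
    by_cases hy : y ∈ s <;> simp [hy, this]
  · rw [hτ.map_eq]
    exact hF.aestronglyMeasurable.indicator hs'

/-- The image of `ρ` satisfies the defining identity of the square as well, because composing with
`τ` does not change conditional expectations on invariant sets. Uniqueness concludes. -/
lemma IsRelIndepSquare.measurePreserving_prodMap {τ : Y → Y} (hτ : MeasurePreserving τ ν ν)
    (h : IsRelIndepSquare (MeasurableSpace.invariants τ) ν ρ) :
    MeasurePreserving (fun z : Y × Y => (τ z.1, τ z.2)) ρ ρ := by
  have := h.1
  have hI := MeasurableSpace.invariants_le τ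
  have hm : Measurable (fun z : Y × Y => (τ z.1, τ z.2)) :=
    (hτ.measurable.comp measurable_fst).prodMk (hτ.measurable.comp measurable_snd)
  have mp1 := h.measurePreserving_fst hI
  have mp2 := h.measurePreserving_snd hI
  refine ⟨hm, IsRelIndepSquare.unique
    ⟨Measure.isProbabilityMeasure_map hm.aemeasurable, fun F G hF hG => ?_⟩ h⟩
  have mF := hF.comp_measurePreserving hτ
  have mG := hG.comp_measurePreserving hτ
  -- `F` and `G` are only a.e. strongly measurable for `ν`, so the marginals of the image measure
  -- are needed before the change of variables.
  have hmap : Measure.map Prod.fst (Measure.map (fun z : Y × Y => (τ z.1, τ z.2)) ρ) = ν := by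
    rw [Measure.map_map measurable_fst hm]
    exact (hτ.comp mp1).map_eq
  have hmap' : Measure.map Prod.snd (Measure.map (fun z : Y × Y => (τ z.1, τ z.2)) ρ) = ν := by
    rw [Measure.map_map measurable_snd hm]
    exact (hτ.comp mp2).map_eq
  rw [integral_map hm.aemeasurable]
  · refine (h.2 _ _ mF mG).trans ?_
    refine integral_congr_ae ?_
    filter_upwards [condExp_invariants_comp_ae_eq hτ (hF.integrable le_top),
      condExp_invariants_comp_ae_eq hτ (hG.integrable le_top)] with y h1 h2
    rw [← h1, ← h2]
  · refine AEStronglyMeasurable.mul ?_ ?_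
    · exact (hF.1.comp_measurePreserving ⟨measurable_fst, hmap⟩)
    · exact (hG.1.comp_measurePreserving ⟨measurable_snd, hmap'⟩)

end RelIndepSquare

/-! ### Cube integrals: positivity, monotonicity and their inductive description. -/

section Cubes

variable {X : Type u}

lemma cubeProd_mul (f g : X → ℝ) (k : ℕ) (y : Cube X k) :
    cubeProd (fun x => f x * g x) k y = cubeProd f k y * cubeProd g k y := by
  induction k with
  | zero => rfl
  | succ k ih =>
    change cubeProd _ k y.1 * cubeProd _ k y.2
      = cubeProd f k y.1 * cubeProd f k y.2 * (cubeProd g k y.1 * cubeProd g k y.2)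
    rw [ih, ih]
    ring

lemma cubeProd_comp (f : X → ℝ) (T : X → X) (k : ℕ) (y : Cube X k) :
    cubeProd (fun x => f (T x)) k y = cubeProd f k (cubeMap T k y) := by
  induction k with
  | zero => rfl
  | succ k ih =>
    change cubeProd _ k y.1 * cubeProd _ k y.2
      = cubeProd f k (cubeMap T k y.1) * cubeProd f k (cubeMap T k y.2)
    rw [ih, ih]

lemma cubeProd_comp_iterate (f : X → ℝ) (T : X → X) (k n : ℕ) (y : Cube X k) :
    cubeProd (fun x => f (T^[n] x)) k y = cubeProd f k ((cubeMap T k)^[n] y) := by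
  induction n generalizing y with
  | zero => rfl
  | succ n ih =>
    rw [Function.iterate_succ_apply, ← ih]
    exact cubeProd_comp (fun x => f (T^[n] x)) T k y

variable [MeasurableSpace X] {μ : Measure X} {T : X → X}

lemma HasHostKraMeasure.of_succ {k : ℕ} (h : HasHostKraMeasure T μ (k + 1)) :
    HasHostKraMeasure T μ k := by
  obtain ⟨_, ν, hν, _⟩ := h
  exact ⟨ν, hν⟩

lemma hostKraMeasure_zero : hostKraMeasure T μ 0 = μ :=
  isHostKraMeasure_hostKraMeasure (k := 0) ⟨μ, rfl⟩

/-- The `2 ^ k`-th power of the `k`-th Host-Kra seminorm. -/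
noncomputable def cubeIntegral (T : X → X) (μ : Measure X) (k : ℕ) (f : X → ℝ) : ℝ :=
  ∫ y, cubeProd f k y ∂(hostKraMeasure T μ k)

lemma cubeIntegral_zero (f : X → ℝ) : cubeIntegral T μ 0 f = ∫ x, f x ∂μ := by
  rw [cubeIntegral, hostKraMeasure_zero]
  rfl

lemma cubeIntegral_mul_iterate (f : X → ℝ) (k m n : ℕ) :
    cubeIntegral T μ k (fun x => f (T^[m] x) * f (T^[n] x)) =
      ∫ y, cubeProd f k ((cubeMap T k)^[m] y) * cubeProd f k ((cubeMap T k)^[n] y)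
        ∂(hostKraMeasure T μ k) := by
  simp only [cubeIntegral, cubeProd_mul, cubeProd_comp_iterate]

variable [IsProbabilityMeasure μ]

lemma HasHostKraMeasure.isProbabilityMeasure {k : ℕ} (h : HasHostKraMeasure T μ k) :
    IsProbabilityMeasure (hostKraMeasure T μ k) :=
  isProbabilityMeasure_of_isHostKraMeasure (isHostKraMeasure_hostKraMeasure h)

lemma isRelIndepSquare_hostKraMeasure {k : ℕ} (h : HasHostKraMeasure T μ (k + 1)) :
    IsRelIndepSquare (MeasurableSpace.invariants (cubeMap T k)) (hostKraMeasure T μ k)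
      (hostKraMeasure T μ (k + 1)) := by
  obtain ⟨ν, hν, h2⟩ := isHostKraMeasure_hostKraMeasure h
  rwa [(isHostKraMeasure_hostKraMeasure h.of_succ).unique hν]

lemma memLp_cubeProd {f : X → ℝ} (hf : MemLp f ∞ μ) {k : ℕ} (h : HasHostKraMeasure T μ k) :
    MemLp (cubeProd f k) ∞ (hostKraMeasure T μ k) := by
  induction k with
  | zero => rw [hostKraMeasure_zero]; exact hf
  | succ k ih =>
    have := h.of_succ.isProbabilityMeasure
    have hsq := isRelIndepSquare_hostKraMeasure h
    have hI := MeasurableSpace.invariants_le (cubeMap T k)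
    have m1 := (ih h.of_succ).comp_measurePreserving (hsq.measurePreserving_fst hI)
    have m2 := (ih h.of_succ).comp_measurePreserving (hsq.measurePreserving_snd hI)
    exact m2.mul m1 (r := ∞)

lemma measurePreserving_cubeMap (hT : MeasurePreserving T μ μ) {k : ℕ}
    (h : HasHostKraMeasure T μ k) :
    MeasurePreserving (cubeMap T k) (hostKraMeasure T μ k) (hostKraMeasure T μ k) := by
  induction k with
  | zero => rw [hostKraMeasure_zero]; exact hT
  | succ k ih =>
    have := h.of_succ.isProbabilityMeasure
    exact (isRelIndepSquare_hostKraMeasure h).measurePreserving_prodMap (ih h.of_succ)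

lemma cubeIntegral_succ {f : X → ℝ} (hf : MemLp f ∞ μ) {k : ℕ}
    (h : HasHostKraMeasure T μ (k + 1)) :
    cubeIntegral T μ (k + 1) f =
      ∫ y, ((hostKraMeasure T μ k)[cubeProd f k | MeasurableSpace.invariants (cubeMap T k)]) y *
        ((hostKraMeasure T μ k)[cubeProd f k | MeasurableSpace.invariants (cubeMap T k)]) y
        ∂(hostKraMeasure T μ k) :=
  (isRelIndepSquare_hostKraMeasure h).2 _ _ (memLp_cubeProd hf h.of_succ)
    (memLp_cubeProd hf h.of_succ)

lemma cubeIntegral_succ_nonneg {f : X → ℝ} (hf : MemLp f ∞ μ) {k : ℕ}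
    (h : HasHostKraMeasure T μ (k + 1)) : 0 ≤ cubeIntegral T μ (k + 1) f := by
  rw [cubeIntegral_succ hf h]
  exact integral_nonneg fun y => mul_self_nonneg _

/-- Jensen's inequality for the conditional expectation of the cube product. For nonnegative cube
integrals it says that the seminorms increase with the order. -/
lemma cubeIntegral_sq_le {f : X → ℝ} (hf : MemLp f ∞ μ) {k : ℕ}
    (h : HasHostKraMeasure T μ (k + 1)) :
    cubeIntegral T μ k f ^ 2 ≤ cubeIntegral T μ (k + 1) f := by
  have := h.of_succ.isProbabilityMeasure
  have hI := MeasurableSpace.invariants_le (cubeMap T k)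
  have hF := (memLp_cubeProd hf h.of_succ).mono_exponent (p := 2) le_top
  rw [cubeIntegral_succ hf h, cubeIntegral, ← integral_condExp hI]
  have := ConvexOn.map_integral_le (μ := hostKraMeasure T μ k) (s := Set.univ)
    (even_two.convexOn_pow (𝕜 := ℝ)) (by fun_prop) isClosed_univ (by simp)
    (integrable_condExp (m := MeasurableSpace.invariants (cubeMap T k)) (f := cubeProd f k))
    (memLp_two_condExp hF _).integrable_sq
  simpa [sq] using this

/-- The mean ergodic theorem on `X^[k]`: correlations of the cube product of `f` under the diagonal
map are cube integrals of `f ∘ T^m * f ∘ T^n`. -/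
lemma tendsto_pairAvg_cubeIntegral (hT : MeasurePreserving T μ μ) {f : X → ℝ} (hf : MemLp f ∞ μ)
    {k : ℕ} (h : HasHostKraMeasure T μ (k + 1)) :
    Tendsto (pairAvg fun m n => cubeIntegral T μ k (fun x => f (T^[m] x) * f (T^[n] x))) atTop
      (nhds (cubeIntegral T μ (k + 1) f)) := by
  have := h.of_succ.isProbabilityMeasure
  simp only [cubeIntegral_mul_iterate, cubeIntegral_succ hf h]
  exact tendsto_pairAvg_integral (measurePreserving_cubeMap hT h.of_succ)
    ((memLp_cubeProd hf h.of_succ).mono_exponent le_top)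

lemma cubeIntegral_succ_le_pairAvg (hT : MeasurePreserving T μ μ) {f : X → ℝ} (hf : MemLp f ∞ μ)
    {k : ℕ} (h : HasHostKraMeasure T μ (k + 1)) {M : ℕ} (hM : 0 < M) :
    cubeIntegral T μ (k + 1) f ≤
      pairAvg (fun m n => cubeIntegral T μ k (fun x => f (T^[m] x) * f (T^[n] x))) M := by
  have := h.of_succ.isProbabilityMeasure
  simp only [cubeIntegral_mul_iterate, cubeIntegral_succ hf h]
  exact integral_condExp_sq_le_pairAvg (measurePreserving_cubeMap hT h.of_succ)
    ((memLp_cubeProd hf h.of_succ).mono_exponent le_top) hM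

end Cubes

/-! ### Elementary properties of averages over pairs. -/

section PairAvg

lemma pairAvg_mono {a b : ℕ → ℕ → ℝ} {M : ℕ} (h : ∀ m < M, ∀ n < M, a m n ≤ b m n) :
    pairAvg a M ≤ pairAvg b M := by
  refine mul_le_mul_of_nonneg_left (Finset.sum_le_sum fun m hm => Finset.sum_le_sum fun n hn => ?_)
    (by positivity)
  exact h m (Finset.mem_range.1 hm) n (Finset.mem_range.1 hn)

lemma pairAvg_add_const (a : ℕ → ℕ → ℝ) (c : ℝ) {M : ℕ} (hM : 0 < M) :
    pairAvg (fun m n => a m n + c) M = pairAvg a M + c := by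
  have : (M : ℝ) ≠ 0 := by positivity
  simp only [pairAvg, Finset.sum_add_distrib, Finset.sum_const, Finset.card_range, nsmul_eq_mul]
  field_simp

lemma pairAvg_comm (a : ℕ → ℕ → ℕ → ℕ → ℝ) (M N : ℕ) :
    pairAvg (fun n n' => pairAvg (a n n') M) N
      = pairAvg (fun m m' => pairAvg (fun n n' => a n n' m m') N) M := by
  have key : ∀ b : ℕ → ℕ → ℕ → ℕ → ℝ, ∀ M N : ℕ, pairAvg (fun n n' => pairAvg (b n n') M) N
      = ((N : ℝ) ^ 2)⁻¹ * ((M : ℝ) ^ 2)⁻¹ * ∑ q ∈ Finset.range N ×ˢ Finset.range N,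
        ∑ r ∈ Finset.range M ×ˢ Finset.range M, b q.1 q.2 r.1 r.2 := by
    intro b M N
    simp only [pairAvg, ← Finset.mul_sum, mul_assoc, Finset.sum_product]
  rw [key, key, Finset.sum_comm, mul_comm ((N : ℝ) ^ 2)⁻¹]

end PairAvg

/-! ### Comparison of an ergodic map with a commuting one. -/

section Ergodic

variable {X : Type u} [MeasurableSpace X] {μ : Measure X} {S T : X → X}

lemma memLp_top_mul_comp {f g : X → ℝ} (hf : MemLp f ∞ μ) (hg : MemLp g ∞ μ) {σ τ : X → X}
    (hσ : MeasurePreserving σ μ μ) (hτ : MeasurePreserving τ μ μ) :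
    MemLp (fun x => f (σ x) * g (τ x)) ∞ μ :=
  (hg.comp_measurePreserving hτ).mul (hf.comp_measurePreserving hσ) (r := ∞)

variable [IsProbabilityMeasure μ]

/-- The Host-Kra seminorms of `T` control the averages along any ergodic map `S` that commutes
with `T`. -/
theorem eventually_pairAvg_cubeIntegral_le (hS : Ergodic S μ) (hT : MeasurePreserving T μ μ)
    (hST : Function.Commute S T) {k : ℕ} (h : HasHostKraMeasure T μ (k + 1)) {f : X → ℝ}
    (hf : MemLp f ∞ μ) {ε : ℝ} (hε : 0 < ε) :
    ∀ᶠ N in atTop,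
      pairAvg (fun m n => cubeIntegral T μ k (fun x => f (S^[m] x) * f (S^[n] x))) N
        ≤ cubeIntegral T μ (k + 1) f + ε := by
  induction k generalizing f ε with
  | zero =>
    -- At order zero ergodicity of `S` makes the limit `(∫ f)^2`, which no longer depends on `S`.
    have h1 := tendsto_pairAvg_integral_of_ergodic hS (hf.mono_exponent (p := 2) le_top)
    have h2 := cubeIntegral_sq_le hf h
    simp only [cubeIntegral_zero] at h2 ⊢
    filter_upwards [h1.eventually (gt_mem_nhds (lt_add_of_pos_right _ hε))] with N hN
    linarith
  | succ k ih =>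
    have hk := h.of_succ
    have hM : ∀ᶠ M in atTop, pairAvg (fun m n =>
        cubeIntegral T μ (k + 1) (fun x => f (T^[m] x) * f (T^[n] x))) M
          < cubeIntegral T μ (k + 2) f + ε / 2 :=
      (tendsto_pairAvg_cubeIntegral hT hf h).eventually
        (gt_mem_nhds (lt_add_of_pos_right _ (half_pos hε)))
    -- `M` is fixed before `N`, so the induction hypothesis is needed only for finitely many pairs
    -- `(m, n)`.
    obtain ⟨M, hM, hM0⟩ := (hM.and (eventually_gt_atTop 0)).exists
    have hq : ∀ m n, MemLp (fun x => f (T^[m] x) * f (T^[n] x)) ∞ μ := fun m n =>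
      memLp_top_mul_comp hf hf (hT.iterate m) (hT.iterate n)
    have hN : ∀ᶠ N in atTop, ∀ m ∈ Finset.range M, ∀ n ∈ Finset.range M,
        pairAvg (fun i j => cubeIntegral T μ k (fun x =>
          (f (T^[m] (S^[i] x)) * f (T^[n] (S^[i] x)))
            * (f (T^[m] (S^[j] x)) * f (T^[n] (S^[j] x))))) N
          ≤ cubeIntegral T μ (k + 1) (fun x => f (T^[m] x) * f (T^[n] x)) + ε / 2 :=
      (Filter.eventually_all_finset _).2 fun m _ => (Filter.eventually_all_finset _).2 fun n _ =>
        ih hk (hq m n) (half_pos hε)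
    filter_upwards [hN] with N hN
    have hcomm : ∀ m i x, S^[i] (T^[m] x) = T^[m] (S^[i] x) := fun m i x =>
      (hST.iterate_iterate i m) x
    calc _ ≤ pairAvg (fun i j => pairAvg (fun m n => cubeIntegral T μ k (fun x =>
          (f (T^[m] (S^[i] x)) * f (T^[n] (S^[i] x)))
            * (f (T^[m] (S^[j] x)) * f (T^[n] (S^[j] x))))) M) N := by
          refine pairAvg_mono fun i _ j _ => ?_
          refine (cubeIntegral_succ_le_pairAvg hT (memLp_top_mul_comp hf hf
            (hS.toMeasurePreserving.iterate i) (hS.toMeasurePreserving.iterate j)) hk hM0).trans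
            (pairAvg_mono fun m _ n _ => le_of_eq ?_)
          congr 1
          ext x
          simp only [hcomm]
          ring
      _ = _ := pairAvg_comm _ _ _
      _ ≤ pairAvg (fun m n => cubeIntegral T μ (k + 1)
          (fun x => f (T^[m] x) * f (T^[n] x)) + ε / 2) M :=
          pairAvg_mono fun m hm n hn => hN m (Finset.mem_range.2 hm) n (Finset.mem_range.2 hn)
      _ ≤ _ := by
          rw [pairAvg_add_const _ _ hM0]
          linarith

end Ergodic

/-! ### Averages along Følner sequences and van der Corput's inequality. -/

section Foelner

open scoped Pointwise symmDiff Topology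

/-- The average of `v` over a finite set. -/
noncomputable def finsetAvg {G H : Type*} [AddCommGroup H] [Module ℝ H] (Φ : Finset G) (v : G → H) :
    H :=
  (Φ.card : ℝ)⁻¹ • ∑ u ∈ Φ, v u

lemma norm_finsetAvg_le {G H : Type*} [NormedAddCommGroup H] [NormedSpace ℝ H] (Φ : Finset G)
    {v : G → H} (hv : ∀ u, ‖v u‖ ≤ 1) : ‖finsetAvg Φ v‖ ≤ 1 := by
  rw [finsetAvg, norm_smul, norm_inv, Real.norm_natCast]
  have h : ‖∑ u ∈ Φ, v u‖ ≤ Φ.card := by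
    simpa using norm_sum_le_of_le Φ fun u _ => hv u
  rcases Nat.eq_zero_or_pos Φ.card with h0 | h0
  · simp [h0]
  · rw [inv_mul_le_iff₀ (by positivity)]
    simpa using h

lemma sq_norm_finsetAvg_le {G H : Type*} [NormedAddCommGroup H] [NormedSpace ℝ H] (Φ : Finset G)
    (v : G → H) : ‖finsetAvg Φ v‖ ^ 2 ≤ finsetAvg Φ fun u => ‖v u‖ ^ 2 := by
  rw [finsetAvg, norm_smul, norm_inv, Real.norm_natCast, finsetAvg, smul_eq_mul, mul_pow]
  rcases Nat.eq_zero_or_pos Φ.card with h0 | h0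
  · simp [h0]
  · have h1 : ‖∑ u ∈ Φ, v u‖ ^ 2 ≤ Φ.card * ∑ u ∈ Φ, ‖v u‖ ^ 2 :=
      (pow_le_pow_left₀ (norm_nonneg _) (norm_sum_le _ _) 2).trans sq_sum_le_card_mul_sum_sq
    have h2 : (0 : ℝ) < Φ.card := by positivity
    calc _ ≤ ((Φ.card : ℝ)⁻¹) ^ 2 * (Φ.card * ∑ u ∈ Φ, ‖v u‖ ^ 2) := by gcongr
      _ = _ := by field_simp

variable {G : Type*} [AddCommGroup G] [MeasurableSpace G] [MeasurableSingletonClass G]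
  {Φ : ℕ → Finset G}

lemma IsAddFoelner.tendsto_card_symmDiff [DecidableEq G]
    (hΦ : IsAddFoelner G Measure.count atTop (fun N => (Φ N : Set G))) (g : G) :
    Tendsto (fun N => (((g +ᵥ Φ N) ∆ Φ N).card : ℝ) / (Φ N).card) atTop (𝓝 0) := by
  have h := (ENNReal.tendsto_toReal ENNReal.zero_ne_top).comp (hΦ.tendsto_meas_vadd_symmDiff g)
  refine h.congr fun N => ?_
  rw [Function.comp_apply, ← Finset.coe_vadd_finset, ← Finset.coe_symmDiff,
    Measure.count_apply_finset, Measure.count_apply_finset, ENNReal.toReal_div]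
  simp

lemma IsAddFoelner.tendsto_finsetAvg_sub {H : Type*} [NormedAddCommGroup H] [NormedSpace ℝ H]
    (hΦ : IsAddFoelner G Measure.count atTop (fun N => (Φ N : Set G))) {v : G → H}
    (hv : ∀ u, ‖v u‖ ≤ 1) (g : G) :
    Tendsto (fun N => finsetAvg (Φ N) v - finsetAvg (Φ N) fun u => v (u + g)) atTop (𝓝 0) := by
  classical
  refine squeeze_zero_norm (fun N => ?_) (hΦ.tendsto_card_symmDiff g)
  have e : ∑ u ∈ Φ N, v (u + g) = ∑ u ∈ g +ᵥ Φ N, v u := by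
    rw [Finset.vadd_finset_def, Finset.sum_image fun a _ b _ h => vadd_left_cancel g h]
    simp [add_comm]
  have e2 : ∑ u ∈ Φ N, v u - ∑ u ∈ g +ᵥ Φ N, v u
      = ∑ u ∈ Φ N \ (g +ᵥ Φ N), v u - ∑ u ∈ (g +ᵥ Φ N) \ Φ N, v u := by
    rw [Finset.sum_sdiff_sub_sum_sdiff]
  have b : ∀ s : Finset G, ‖∑ u ∈ s, v u‖ ≤ s.card := fun s => by
    simpa using norm_sum_le_of_le s fun u _ => hv u
  have hcard : ((((g +ᵥ Φ N) ∆ Φ N).card : ℕ) : ℝ)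
      = (((g +ᵥ Φ N) \ Φ N).card : ℝ) + ((Φ N \ (g +ᵥ Φ N)).card : ℝ) := by
    rw [Finset.symmDiff_def, Finset.card_union_of_disjoint disjoint_sdiff_sdiff, Nat.cast_add]
  rw [finsetAvg, finsetAvg, e, ← smul_sub, e2, norm_smul, norm_inv, Real.norm_natCast, hcard,
    div_eq_inv_mul]
  gcongr
  refine (norm_sub_le _ _).trans ?_
  linarith [b (Φ N \ (g +ᵥ Φ N)), b ((g +ᵥ Φ N) \ Φ N)]

/-- The **van der Corput inequality** along a Følner sequence, for shifts by multiples of `e`. -/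
theorem IsAddFoelner.eventually_sq_norm_finsetAvg_le {H : Type*} [NormedAddCommGroup H]
    [InnerProductSpace ℝ H]
    (hΦ : IsAddFoelner G Measure.count atTop (fun N => (Φ N : Set G))) {v : G → H}
    (hv : ∀ u, ‖v u‖ ≤ 1) (e : G) {M : ℕ} (hM : 0 < M) {c : ℕ → ℕ → ℝ}
    (hc : ∀ m n, ∀ ε > 0, ∀ᶠ N in atTop,
      finsetAvg (Φ N) (fun u => inner ℝ (v (u + m • e)) (v (u + n • e))) ≤ c m n + ε)
    {ε : ℝ} (hε : 0 < ε) :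
    ∀ᶠ N in atTop, ‖finsetAvg (Φ N) v‖ ^ 2 ≤ pairAvg c M + ε := by
  have hM' : (M : ℝ) ≠ 0 := by positivity
  -- Replacing `v` by its mean over `M` shifts changes the Følner averages by `o(1)`, while `‖w u‖ ^
  -- 2` expands into the correlations.
  set w : G → H := fun u => finsetAvg (Finset.range M) fun m => v (u + m • e) with hw
  have hw1 : ∀ u, ‖w u‖ ≤ 1 := fun u => norm_finsetAvg_le _ fun m => hv _
  have hdiff : Tendsto (fun N => finsetAvg (Φ N) v - finsetAvg (Φ N) w) atTop (𝓝 0) := by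
    have h1 : Tendsto (fun N => finsetAvg (Finset.range M) fun m =>
        (finsetAvg (Φ N) v - finsetAvg (Φ N) fun u => v (u + m • e))) atTop (𝓝 0) := by
      have := (tendsto_finsetSum (Finset.range M) fun m _ =>
        hΦ.tendsto_finsetAvg_sub hv (m • e)).const_smul ((M : ℝ)⁻¹)
      simpa [finsetAvg] using this
    refine h1.congr fun N => ?_
    simp only [hw, finsetAvg, Finset.sum_sub_distrib, Finset.sum_const, Finset.card_range, smul_sub]
    congr 1
    · rw [← Nat.cast_smul_eq_nsmul ℝ, smul_smul, inv_mul_cancel₀ hM', one_smul]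
    · rw [← Finset.smul_sum, ← Finset.smul_sum, Finset.sum_comm, smul_comm]
  have hwsq : ∀ u, ‖w u‖ ^ 2
      = pairAvg (fun m n => inner ℝ (v (u + m • e)) (v (u + n • e))) M := by
    intro u
    have e1 : w u = (M : ℝ)⁻¹ • ∑ m ∈ Finset.range M, v (u + m • e) := by
      simp only [hw, finsetAvg, Finset.card_range]
    rw [← real_inner_self_eq_norm_sq, e1, real_inner_smul_left, real_inner_smul_right,
      sum_inner, pairAvg, ← mul_assoc, sq, mul_inv]
    simp only [inner_sum]
  have hswap : ∀ N, finsetAvg (Φ N) (fun u => ‖w u‖ ^ 2) = pairAvg (fun m n =>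
      finsetAvg (Φ N) fun u => inner ℝ (v (u + m • e)) (v (u + n • e))) M := by
    intro N
    simp only [hwsq, finsetAvg, pairAvg, smul_eq_mul, ← Finset.mul_sum]
    rw [Finset.sum_comm, mul_left_comm]
    congr 3
    ext m
    rw [Finset.sum_comm]
  have hall : ∀ᶠ N in atTop, ∀ m ∈ Finset.range M, ∀ n ∈ Finset.range M,
      finsetAvg (Φ N) (fun u => inner ℝ (v (u + m • e)) (v (u + n • e))) ≤ c m n + ε / 2 :=
    (Filter.eventually_all_finset _).2 fun m _ => (Filter.eventually_all_finset _).2 fun n _ =>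
      hc m n _ (half_pos hε)
  have hdiff' : ∀ᶠ N in atTop, ‖finsetAvg (Φ N) v - finsetAvg (Φ N) w‖ < ε / 4 := by
    have := hdiff.norm
    rw [norm_zero] at this
    exact this.eventually (gt_mem_nhds (by positivity))
  filter_upwards [hall, hdiff'] with N h1 h2
  have h3 : ‖finsetAvg (Φ N) w‖ ^ 2 ≤ pairAvg c M + ε / 2 := by
    refine (sq_norm_finsetAvg_le _ _).trans ?_
    rw [hswap, ← pairAvg_add_const _ _ hM]
    exact pairAvg_mono fun m hm n hn => h1 m (Finset.mem_range.2 hm) n (Finset.mem_range.2 hn)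
  have h4 := norm_finsetAvg_le (Φ N) hv
  have h5 := norm_finsetAvg_le (Φ N) hw1
  have h6 := norm_sub_norm_le (finsetAvg (Φ N) v) (finsetAvg (Φ N) w)
  -- With both norms at most `1`, the squares differ by at most `2 * (ε / 4)`.
  nlinarith [norm_nonneg (finsetAvg (Φ N) v), norm_nonneg (finsetAvg (Φ N) w)]

end Foelner

/-! ### The `ℤ^l`-action generated by the transformations. -/

section GenPow

lemma commute_list_ofFn_zpow_prod {G : Type*} [Group G] {n : ℕ} {a : G} {g : Fin n → G}
    (h : ∀ i, Commute a (g i)) (c : Fin n → ℤ) :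
    Commute a (List.ofFn fun i => g i ^ c i).prod :=
  Commute.list_prod_right _ _ fun y hy => by
    obtain ⟨i, rfl⟩ := (List.mem_ofFn' _ _).1 hy
    exact (h i).zpow_right (c i)

lemma list_ofFn_zpow_add_prod {G : Type*} [Group G] {n : ℕ} {g : Fin n → G}
    (h : ∀ i j, Commute (g i) (g j)) (c c' : Fin n → ℤ) :
    (List.ofFn fun i => g i ^ (c + c') i).prod
      = (List.ofFn fun i => g i ^ c i).prod * (List.ofFn fun i => g i ^ c' i).prod := by
  induction n with
  | zero => simp
  | succ n ih =>
    have e := ih (fun i j => h i.succ j.succ) (fun i => c i.succ) (fun i => c' i.succ)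
    have hc : Commute (g 0 ^ c' 0) (List.ofFn fun i : Fin n => g i.succ ^ c i.succ).prod :=
      (commute_list_ofFn_zpow_prod (fun i => h 0 i.succ) _).zpow_left _
    simp only [List.ofFn_succ, List.prod_cons, Pi.add_apply, zpow_add] at e ⊢
    rw [e, mul_assoc, mul_assoc, ← mul_assoc (g 0 ^ c' 0), hc.eq, mul_assoc]

variable {X : Type u} [MeasurableSpace X] {l : ℕ} {μ : Measure X} {T : Fin l → X ≃ᵐ X}

/-- The permutations of `X` that preserve `μ` in both directions. -/
def measurePreservingPerm (μ : Measure X) : Subgroup (Equiv.Perm X) where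
  carrier := {σ | MeasurePreserving σ μ μ ∧ MeasurePreserving (σ⁻¹ : Equiv.Perm X) μ μ}
  mul_mem' := fun ha hb => ⟨ha.1.comp hb.1, by
    rw [mul_inv_rev]
    exact hb.2.comp ha.2⟩
  one_mem' := ⟨MeasurePreserving.id μ, MeasurePreserving.id μ⟩
  inv_mem' := fun h => ⟨h.2, by
    rw [inv_inv]
    exact h.1⟩

namespace IsFreelyGeneratedTotallyErgodic

lemma commute_toEquiv (hT : IsFreelyGeneratedTotallyErgodic μ T) (i j : Fin l) :
    Commute ((T i).toEquiv : Equiv.Perm X) ((T j).toEquiv : Equiv.Perm X) :=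
  Equiv.ext fun x => hT.commute i j x

lemma genPow_add (hT : IsFreelyGeneratedTotallyErgodic μ T) (c c' : Fin l → ℤ) :
    genPow T (c + c') = genPow T c * genPow T c' :=
  list_ofFn_zpow_add_prod hT.commute_toEquiv c c'

lemma genPow_add_apply (hT : IsFreelyGeneratedTotallyErgodic μ T)
    (c c' : Fin l → ℤ) (x : X) :
    genPow T (c + c') x = genPow T c (genPow T c' x) := by
  rw [hT.genPow_add]
  rfl

lemma genPow_nsmul_apply (hT : IsFreelyGeneratedTotallyErgodic μ T)
    (n : ℕ) (c : Fin l → ℤ) (x : X) :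
    genPow T (n • c) x = (genPow T c)^[n] x := by
  induction n with
  | zero =>
    have : genPow T (0 : Fin l → ℤ) = 1 := by
      have h := hT.genPow_add 0 0
      rw [add_zero] at h
      exact left_eq_mul.1 h
    rw [zero_smul, this]
    rfl
  | succ n ih =>
    rw [succ_nsmul', hT.genPow_add_apply, ih, Function.iterate_succ_apply']

lemma commute_genPow (hT : IsFreelyGeneratedTotallyErgodic μ T) (c : Fin l → ℤ) (j : Fin l) :
    Function.Commute (genPow T c) (T j) := by
  intro x
  have h := commute_list_ofFn_zpow_prod (hT.commute_toEquiv j) c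
  exact (Equiv.ext_iff.1 h.eq x).symm

lemma measurePreserving_genPow (hT : IsFreelyGeneratedTotallyErgodic μ T) (c : Fin l → ℤ) :
    MeasurePreserving (genPow T c) μ μ := by
  have h : genPow T c ∈ measurePreservingPerm μ := by
    refine Subgroup.list_prod_mem _ fun σ hσ => ?_
    obtain ⟨j, rfl⟩ := (List.mem_ofFn' _ _).1 hσ
    have h : ((T j).toEquiv : Equiv.Perm X) ∈ measurePreservingPerm μ :=
      ⟨hT.measurePreserving j, (hT.measurePreserving j).symm⟩
    exact Subgroup.zpow_mem _ h _
  exact h.1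

end IsFreelyGeneratedTotallyErgodic

/-- Induction through the limit formula: both sides are limits of pair averages one order below,
which agree because `S` commutes with `U`. The action of `S` on the cube measures is never
considered. -/
lemma cubeIntegral_comp [IsProbabilityMeasure μ] {S U : X → X} (hS : MeasurePreserving S μ μ)
    (hU : MeasurePreserving U μ μ) (hSU : Function.Commute S U) {f : X → ℝ} (hf : MemLp f ∞ μ)
    {k : ℕ} (h : HasHostKraMeasure U μ k) :
    cubeIntegral U μ k (fun x => f (S x)) = cubeIntegral U μ k f := by
  induction k generalizing f with
  | zero =>
    rw [cubeIntegral_zero, cubeIntegral_zero]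
    nth_rw 2 [← hS.map_eq]
    rw [integral_map hS.measurable.aemeasurable (by rw [hS.map_eq]; exact hf.1)]
  | succ k ih =>
    refine tendsto_nhds_unique
      (tendsto_pairAvg_cubeIntegral hU (hf.comp_measurePreserving hS) h) ?_
    refine (tendsto_pairAvg_cubeIntegral hU hf h).congr fun M => ?_
    congr 1
    ext m n
    rw [← ih (memLp_top_mul_comp hf hf (hU.iterate m) (hU.iterate n)) h.of_succ]
    congr 1
    ext x
    have e : ∀ i, U^[i] (S x) = S (U^[i] x) := fun i => (hSU.iterate_right i x).symm
    simp only [Function.comp_apply, e]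

end GenPow

/-! ### The power mean inequality for pair averages. -/

section PowerMean

lemma pairAvg_rpow_le {a : ℕ → ℕ → ℝ} (ha : ∀ m n, 0 ≤ a m n) {p : ℕ} (hp : p ≠ 0) {M : ℕ}
    (hM : 0 < M) :
    pairAvg (fun m n => a m n ^ (1 / (p : ℝ))) M ≤ pairAvg a M ^ (1 / (p : ℝ)) := by
  have hw : ∀ b : ℕ → ℕ → ℝ, pairAvg b M = ∑ q ∈ Finset.range M ×ˢ Finset.range M,
      ((M : ℝ) ^ 2)⁻¹ * b q.1 q.2 := fun b => by
    rw [← Finset.mul_sum, Finset.sum_product]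
    rfl
  have hx : 0 ≤ pairAvg (fun m n => a m n ^ (1 / (p : ℝ))) M := by
    rw [hw]
    exact Finset.sum_nonneg fun q _ => mul_nonneg (by positivity) (Real.rpow_nonneg (ha _ _) _)
  have h := Real.pow_arith_mean_le_arith_mean_pow (Finset.range M ×ˢ Finset.range M)
    (fun _ => ((M : ℝ) ^ 2)⁻¹) (fun q => a q.1 q.2 ^ (1 / (p : ℝ))) (fun _ _ => by positivity)
    (by simp; field_simp) (fun q _ => Real.rpow_nonneg (ha _ _) _) p
  rw [← hw (fun m n => a m n ^ (1 / (p : ℝ)))] at h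
  have e : ∀ q : ℕ × ℕ, (a q.1 q.2 ^ (1 / (p : ℝ))) ^ p = a q.1 q.2 := fun q => by
    rw [one_div, Real.rpow_inv_natCast_pow (ha _ _) hp]
  simp only [e] at h
  rw [← hw] at h
  calc _ = (pairAvg (fun m n => a m n ^ (1 / (p : ℝ))) M ^ p) ^ (1 / (p : ℝ)) := by
        conv_lhs => rw [← Real.pow_rpow_inv_natCast hx hp]
        rw [one_div (p : ℝ)]
    _ ≤ _ := Real.rpow_le_rpow (pow_nonneg hx _) h (by positivity)

end PowerMean

/-! ### Functions bounded by one and their classes in `L²`. -/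

section UnitBounded

variable {X : Type u} [MeasurableSpace X] {μ : Measure X}

/-- `f` is a.e. strongly measurable and bounded by `1` almost everywhere. -/
structure IsUnitBounded (f : X → ℝ) (μ : Measure X) : Prop where
  aestronglyMeasurable : AEStronglyMeasurable f μ
  ae_abs_le : ∀ᵐ x ∂μ, |f x| ≤ 1

namespace IsUnitBounded

variable {f g : X → ℝ}

lemma memLp_top (hf : IsUnitBounded f μ) : MemLp f ∞ μ :=
  memLp_top_of_bound hf.1 1 hf.2

lemma comp (hf : IsUnitBounded f μ) {σ : X → X} (hσ : MeasurePreserving σ μ μ) :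
    IsUnitBounded (fun x => f (σ x)) μ :=
  ⟨hf.1.comp_measurePreserving hσ, hσ.quasiMeasurePreserving.ae hf.2⟩

lemma mul (hf : IsUnitBounded f μ) (hg : IsUnitBounded g μ) :
    IsUnitBounded (fun x => f x * g x) μ :=
  ⟨hf.1.mul hg.1, by
    filter_upwards [hf.2, hg.2] with x h1 h2
    rw [abs_mul]
    exact mul_le_one₀ h1 (abs_nonneg _) h2⟩

lemma finsetProd {ι : Type*} {s : Finset ι} {f : ι → X → ℝ}
    (hf : ∀ i ∈ s, IsUnitBounded (f i) μ) : IsUnitBounded (fun x => ∏ i ∈ s, f i x) μ := by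
  classical
  induction s using Finset.induction_on with
  | empty => exact ⟨by simpa using aestronglyMeasurable_const, by simp⟩
  | insert i s hi ih =>
    simp only [Finset.prod_insert hi]
    exact (hf i (Finset.mem_insert_self i s)).mul
      (ih fun i' h => hf i' (Finset.mem_insert_of_mem h))

variable [IsProbabilityMeasure μ]

lemma memLp_two (hf : IsUnitBounded f μ) : MemLp f 2 μ := hf.memLp_top.mono_exponent le_top

/-- The class in `L²` of a function bounded by `1`. -/
noncomputable def toL2 (hf : IsUnitBounded f μ) : Lp ℝ 2 μ := hf.memLp_two.toLp f

lemma norm_toL2_le (hf : IsUnitBounded f μ) : ‖hf.toL2‖ ≤ 1 := by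
  have h := Lp.norm_le_of_ae_bound (f := hf.toL2) zero_le_one (by
    filter_upwards [hf.memLp_two.coeFn_toLp, hf.2] with x h1 h2
    rw [toL2, h1]
    exact h2)
  simpa [measureUnivNNReal] using h

lemma inner_toL2 (hf : IsUnitBounded f μ) (hg : IsUnitBounded g μ) :
    inner ℝ hf.toL2 hg.toL2 = ∫ x, f x * g x ∂μ := inner_toLp _ _

/-- Cauchy-Schwarz, with the factor independent of `u` taken out of the average. -/
lemma finsetAvg_integral_mul_le {G : Type*} (Φ : Finset G) (hf : IsUnitBounded f μ)
    {w : G → X → ℝ} (hw : ∀ u, IsUnitBounded (w u) μ) :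
    finsetAvg Φ (fun u => ∫ x, f x * w u x ∂μ) ≤ ‖finsetAvg Φ fun u => (hw u).toL2‖ := by
  have e : finsetAvg Φ (fun u => ∫ x, f x * w u x ∂μ)
      = inner ℝ hf.toL2 (finsetAvg Φ fun u => (hw u).toL2) := by
    simp only [finsetAvg, real_inner_smul_right, inner_sum, inner_toL2, smul_eq_mul]
  rw [e]
  refine (real_inner_le_norm _ _).trans ?_
  exact mul_le_of_le_one_left (norm_nonneg _) hf.norm_toL2_le

lemma eLpNorm_average {G : Type*} (Φ : Finset G) {w : G → X → ℝ}
    (hw : ∀ u, IsUnitBounded (w u) μ) :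
    eLpNorm (fun x => (Φ.card : ℝ)⁻¹ * ∑ u ∈ Φ, w u x) 2 μ
      = ENNReal.ofReal ‖finsetAvg Φ fun u => (hw u).toL2‖ := by
  rw [Lp.norm_def, ENNReal.ofReal_toReal (Lp.eLpNorm_ne_top _)]
  refine eLpNorm_congr_ae ?_
  have h : ∀ᵐ x ∂μ, ∀ u ∈ Φ, (hw u).toL2 x = w u x :=
    (ae_ball_iff Φ.countable_toSet).2 fun u _ => (hw u).memLp_two.coeFn_toLp
  filter_upwards [h, Lp.coeFn_smul (Φ.card : ℝ)⁻¹ (∑ u ∈ Φ, (hw u).toL2),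
    Lp.coeFn_fun_finsetSum Φ fun u => (hw u).toL2] with x h1 h2 h3
  rw [finsetAvg, h2, Pi.smul_apply, h3, Finset.sum_congr rfl h1, smul_eq_mul]

end IsUnitBounded

end UnitBounded

/-! ### The van der Corput induction on the number of functions. -/

section Correlations

variable {X : Type u} [MeasurableSpace X] {μ : Measure X} {l d : ℕ} {T : Fin l → X ≃ᵐ X}
  {ι : Type*}

/-- The function `x ↦ ∏_{i ∈ s} f_i (T ^ (A_i u) x)`. -/
def orbitProd (T : Fin l → X ≃ᵐ X) (s : Finset ι) (A : ι → (Fin d → ℤ) →+ (Fin l → ℤ))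
    (f : ι → X → ℝ) (u : Fin d → ℤ) (x : X) : ℝ :=
  ∏ i ∈ s, f i (genPow T (A i u) x)

lemma IsUnitBounded.orbitProd (hT : IsFreelyGeneratedTotallyErgodic μ T) {f : ι → X → ℝ}
    (hf : ∀ i, IsUnitBounded (f i) μ) (s : Finset ι) (A : ι → (Fin d → ℤ) →+ (Fin l → ℤ))
    (u : Fin d → ℤ) : IsUnitBounded (orbitProd T s A f u) μ :=
  IsUnitBounded.finsetProd fun i _ => (hf i).comp (hT.measurePreserving_genPow _)

lemma exists_pos_rpow_add_lt {R : ℝ} {q ε : ℝ} (hq : 0 < q) (hε : 0 < ε) :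
    ∃ δ > 0, ((R + δ) ^ q + δ) ^ (1 / 2 : ℝ) < (R ^ q) ^ (1 / 2 : ℝ) + ε := by
  have hc : Continuous fun δ : ℝ => ((R + δ) ^ q + δ) ^ (1 / 2 : ℝ) :=
    (((continuous_const.add continuous_id).rpow_const fun _ => Or.inr hq.le).add
      continuous_id).rpow_const fun _ => Or.inr (by norm_num)
  have h := (hc.tendsto 0).mono_left (nhdsWithin_le_nhds (s := Set.Ioi (0 : ℝ)))
  simp only [add_zero] at h
  obtain ⟨δ, h1, h2⟩ := ((h.eventually (gt_mem_nhds (lt_add_of_pos_right _ hε))).and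
    self_mem_nhdsWithin).exists
  exact ⟨δ, h2, h1⟩

variable [IsProbabilityMeasure μ] {Φ : ℕ → Finset (Fin d → ℤ)}

/-- The half of the induction that raises the order: van der Corput, then the power mean inequality
to bring the average over shifts inside the root, then the comparison of the ergodic map `genPow T
(A i₀ e)` with `T j`. -/
lemma eventually_norm_finsetAvg_le_of_correlation (hT : IsFreelyGeneratedTotallyErgodic μ T)
    (hΦ : IsAddFoelner (Fin d → ℤ) Measure.count atTop (fun N => (Φ N : Set (Fin d → ℤ))))
    {j : Fin l} {k : ℕ} (h : HasHostKraMeasure (T j) μ (k + 1)) {s : Finset ι}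
    {A : ι → (Fin d → ℤ) →+ (Fin l → ℤ)} {i₀ : ι} (hA : A i₀ ≠ 0)
    (hcor : ∀ g : ι → X → ℝ, (∀ i, IsUnitBounded (g i) μ) → ∀ ε > 0, ∀ᶠ N in atTop,
      finsetAvg (Φ N) (fun u => ∫ x, orbitProd T s A g u x ∂μ)
        ≤ cubeIntegral (T j) μ k (g i₀) ^ (1 / ((2 ^ k : ℕ) : ℝ)) + ε)
    {f : ι → X → ℝ} (hf : ∀ i, IsUnitBounded (f i) μ) {ε : ℝ} (hε : 0 < ε) :
    ∀ᶠ N in atTop, ‖finsetAvg (Φ N) fun u => (IsUnitBounded.orbitProd hT hf s A u).toL2‖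
      ≤ cubeIntegral (T j) μ (k + 1) (f i₀) ^ (1 / ((2 ^ (k + 1) : ℕ) : ℝ)) + ε := by
  obtain ⟨e, he⟩ : ∃ e, A i₀ e ≠ 0 := by
    by_contra! hcon
    exact hA (AddMonoidHom.ext hcon)
  set R := cubeIntegral (T j) μ (k + 1) (f i₀) with hR
  have hR0 : 0 ≤ R := cubeIntegral_succ_nonneg (hf i₀).memLp_top h
  -- The inner `δ` pays for the comparison of averages, the outer one for van der Corput.
  obtain ⟨δ, hδ, hδε⟩ := exists_pos_rpow_add_lt (R := R) (q := 1 / ((2 ^ k : ℕ) : ℝ))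
    (by positivity) hε
  have hmp := fun i n => (hT.measurePreserving_genPow (A i e)).iterate n
  set g : ℕ → ℕ → ι → X → ℝ := fun m n i x =>
    f i ((genPow T (A i e))^[m] x) * f i ((genPow T (A i e))^[n] x) with hg
  have hgb : ∀ m n i, IsUnitBounded (g m n i) μ := fun m n i =>
    ((hf i).comp (hmp i m)).mul ((hf i).comp (hmp i n))
  set a : ℕ → ℕ → ℝ := fun m n => cubeIntegral (T j) μ k (g m n i₀) with ha
  obtain ⟨M, hM, hM0⟩ := ((eventually_pairAvg_cubeIntegral_le (hT.ergodic _ he)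
    (hT.measurePreserving j) (hT.commute_genPow _ j) h (hf i₀).memLp_top hδ).and
    (eventually_gt_atTop 0)).exists
  have hpow : pairAvg (fun m n => a m n ^ (1 / ((2 ^ k : ℕ) : ℝ))) M
      ≤ (R + δ) ^ (1 / ((2 ^ k : ℕ) : ℝ)) := by
    -- At order zero the cube integral is a plain integral and may be negative, but the exponent is
    -- then `1`. At higher orders it is nonnegative and the power mean inequality applies.
    rcases k with _ | k
    · simpa using hM
    · have hpos : ∀ m n, 0 ≤ a m n := fun m n =>
        cubeIntegral_succ_nonneg (hgb m n i₀).memLp_top h.of_succ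
      refine (pairAvg_rpow_le hpos (by positivity) hM0).trans ?_
      refine Real.rpow_le_rpow ?_ hM (by positivity)
      exact mul_nonneg (by positivity)
        (Finset.sum_nonneg fun m _ => Finset.sum_nonneg fun n _ => hpos m n)
  have hvdc := hΦ.eventually_sq_norm_finsetAvg_le
    (v := fun u => (IsUnitBounded.orbitProd hT hf s A u).toL2)
    (fun u => IsUnitBounded.norm_toL2_le _) e hM0
    (c := fun m n => a m n ^ (1 / ((2 ^ k : ℕ) : ℝ))) (fun m n ε' hε' => by
      have hin : ∀ u, inner ℝ (IsUnitBounded.orbitProd hT hf s A (u + m • e)).toL2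
          (IsUnitBounded.orbitProd hT hf s A (u + n • e)).toL2
            = ∫ x, orbitProd T s A (g m n) u x ∂μ := by
        intro u
        rw [IsUnitBounded.inner_toL2]
        congr 1
        ext x
        have hsh : ∀ (i : ι) (n : ℕ), genPow T (A i (u + n • e)) x
            = (genPow T (A i e))^[n] (genPow T (A i u) x) := fun i n => by
          rw [map_add, map_nsmul, add_comm, hT.genPow_add_apply, hT.genPow_nsmul_apply]
        simp only [orbitProd, hg, hsh, Finset.prod_mul_distrib]
      simp only [hin]
      exact hcor (g m n) (hgb m n) ε' hε') hδ
  filter_upwards [hvdc] with N hN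
  have h1 : ‖finsetAvg (Φ N) fun u => (IsUnitBounded.orbitProd hT hf s A u).toL2‖ ^ 2
      ≤ (R + δ) ^ (1 / ((2 ^ k : ℕ) : ℝ)) + δ := by linarith
  have h2 : (R ^ (1 / ((2 ^ k : ℕ) : ℝ))) ^ (1 / 2 : ℝ)
      = R ^ (1 / ((2 ^ (k + 1) : ℕ) : ℝ)) := by
    rw [← Real.rpow_mul hR0]
    congr 1
    push_cast
    rw [pow_succ]
    field_simp
  rw [← h2]
  refine le_trans ?_ hδε.le
  rw [← Real.sqrt_eq_rpow]
  exact Real.le_sqrt_of_sq_le h1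

/-- The half that lowers the number of functions. Distinctness of the `A i` is enough here: it is
inherited by the differences, and it makes the difference at `i₀` nonzero. -/
lemma eventually_correlation_le (hT : IsFreelyGeneratedTotallyErgodic μ T)
    (hΦ : IsAddFoelner (Fin d → ℤ) Measure.count atTop (fun N => (Φ N : Set (Fin d → ℤ))))
    {j : Fin l} {k : ℕ} (h : HasHostKraMeasure (T j) μ k) {s : Finset ι} (hs : s.card = k + 1)
    {A : ι → (Fin d → ℤ) →+ (Fin l → ℤ)} (hA : ∀ i ∈ s, ∀ i' ∈ s, i ≠ i' → A i ≠ A i')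
    {i₀ : ι} (hi₀ : i₀ ∈ s) (g : ι → X → ℝ) (hg : ∀ i, IsUnitBounded (g i) μ) {ε : ℝ}
    (hε : 0 < ε) :
    ∀ᶠ N in atTop, finsetAvg (Φ N) (fun u => ∫ x, orbitProd T s A g u x ∂μ)
      ≤ cubeIntegral (T j) μ k (g i₀) ^ (1 / ((2 ^ k : ℕ) : ℝ)) + ε := by
  classical
  induction k generalizing s A g ε with
  | zero =>
    obtain ⟨i, rfl⟩ := Finset.card_eq_one.1 hs
    obtain rfl := Finset.mem_singleton.1 hi₀
    have e : ∀ u, ∫ x, orbitProd T {i₀} A g u x ∂μ = ∫ x, g i₀ x ∂μ := by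
      intro u
      have hm := hT.measurePreserving_genPow (A i₀ u)
      simp only [orbitProd, Finset.prod_singleton]
      conv_rhs => rw [← hm.map_eq]
      rw [integral_map hm.measurable.aemeasurable (by rw [hm.map_eq]; exact (hg i₀).1)]
    -- The average over an empty set is `0`, so the constant is recovered only once `Φ N` is
    -- nonempty.
    filter_upwards [hΦ.eventually_meas_ne_zero] with N hN
    have hc : ((Φ N).card : ℝ) ≠ 0 := by
      have hne : (Φ N).Nonempty := by
        rw [Finset.nonempty_iff_ne_empty]
        rintro h0
        simp [h0] at hN
      have := hne.card_pos
      positivity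
    simp only [e, finsetAvg, Finset.sum_const, cubeIntegral_zero, pow_zero, Nat.cast_one, div_one,
      Real.rpow_one]
    rw [← Nat.cast_smul_eq_nsmul ℝ, smul_smul, inv_mul_cancel₀ hc, one_smul]
    linarith
  | succ k ih =>
    -- The function moved to time zero is estimated trivially, so it must not be the one at `i₀`.
    obtain ⟨i₁, hi₁, hne⟩ := Finset.exists_mem_ne (by omega : 1 < s.card) i₀
    set B : ι → (Fin d → ℤ) →+ (Fin l → ℤ) := fun i => A i - A i₁ with hB
    have hcard : (s.erase i₁).card = k + 1 := by
      rw [Finset.card_erase_of_mem hi₁, hs]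
      rfl
    have hi₀' : i₀ ∈ s.erase i₁ := Finset.mem_erase.2 ⟨hne.symm, hi₀⟩
    have hB0 : B i₀ ≠ 0 := sub_ne_zero.2 (hA i₀ hi₀ i₁ hi₁ hne.symm)
    have hBne : ∀ i ∈ s.erase i₁, ∀ i' ∈ s.erase i₁, i ≠ i' → B i ≠ B i' :=
      fun i hi i' hi' hii he => hA i (Finset.mem_of_mem_erase hi) i' (Finset.mem_of_mem_erase hi')
        hii (sub_left_injective he)
    have key := eventually_norm_finsetAvg_le_of_correlation hT hΦ h hB0
      (fun g hg ε hε => ih h.of_succ hcard hBne hi₀' g hg hε) hg hε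
    filter_upwards [key] with N hN
    refine le_trans ?_ hN
    have e : ∀ u, ∫ x, orbitProd T s A g u x ∂μ
        = ∫ x, g i₁ x * orbitProd T (s.erase i₁) B g u x ∂μ := by
      intro u
      have hm := hT.measurePreserving_genPow (A i₁ u)
      have hb : IsUnitBounded (fun x => g i₁ x * orbitProd T (s.erase i₁) B g u x) μ :=
        (hg i₁).mul (IsUnitBounded.orbitProd hT hg _ _ _)
      conv_rhs => rw [← hm.map_eq]
      rw [integral_map hm.measurable.aemeasurable (by rw [hm.map_eq]; exact hb.1)]
      congr 1
      ext x
      rw [orbitProd, orbitProd, ← Finset.mul_prod_erase s _ hi₁]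
      congr 1
      refine Finset.prod_congr rfl fun i _ => ?_
      rw [← hT.genPow_add_apply, hB, AddMonoidHom.sub_apply, sub_add_cancel]
    simp only [e]
    exact IsUnitBounded.finsetAvg_integral_mul_le _ (hg i₁) _

/-- The averages of `∏_{i ∈ s} f_i (T ^ (A_i u) x)` are controlled by the Host-Kra seminorm of order
`#s` of each of the functions, if the `A_i` are nonzero and distinct. -/
theorem eventually_norm_finsetAvg_orbitProd_le (hT : IsFreelyGeneratedTotallyErgodic μ T)
    (hΦ : IsAddFoelner (Fin d → ℤ) Measure.count atTop (fun N => (Φ N : Set (Fin d → ℤ))))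
    {j : Fin l} {s : Finset ι} (h : HasHostKraMeasure (T j) μ s.card)
    {A : ι → (Fin d → ℤ) →+ (Fin l → ℤ)} (hA0 : ∀ i ∈ s, A i ≠ 0)
    (hA : ∀ i ∈ s, ∀ i' ∈ s, i ≠ i' → A i ≠ A i') {i₀ : ι} (hi₀ : i₀ ∈ s) {f : ι → X → ℝ}
    (hf : ∀ i, IsUnitBounded (f i) μ) {ε : ℝ} (hε : 0 < ε) :
    ∀ᶠ N in atTop, ‖finsetAvg (Φ N) fun u => (IsUnitBounded.orbitProd hT hf s A u).toL2‖
      ≤ cubeIntegral (T j) μ s.card (f i₀) ^ (1 / ((2 ^ s.card : ℕ) : ℝ)) + ε := by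
  obtain ⟨k, hk⟩ : ∃ k, s.card = k + 1 :=
    Nat.exists_eq_succ_of_ne_zero (Finset.card_ne_zero_of_mem hi₀)
  rw [hk] at h ⊢
  exact eventually_norm_finsetAvg_le_of_correlation hT hΦ h (hA0 i₀ hi₀)
    (fun g hg ε hε => eventually_correlation_le hT hΦ h.of_succ hk hA hi₀ g hg hε) hf hε

end Correlations

/-! ### Linear parts of an ED-set. -/

section LinearPart

variable {d l r : ℕ}

/-- The additive map `ℤ^d → ℤ^l` with the given coefficients. -/
def linearPart (a : Fin l → Fin d → ℤ) : (Fin d → ℤ) →+ (Fin l → ℤ) :=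
  AddMonoidHom.mk' (fun u j => ∑ k, a j k * u k) fun u v => by
    ext j
    simp [mul_add, Finset.sum_add_distrib]

/-- The rows of an ED-set of linear functions have nonzero distinct linear parts. -/
lemma IsEDSet.exists_linearPart {p : Fin r → Fin l → (Fin d → ℤ) → ℤ}
    (hlin : ∀ i j, IsLinearFunction (p i j)) (hED : IsEDSet p) :
    ∃ (A : Fin r → (Fin d → ℤ) →+ (Fin l → ℤ)) (c : Fin r → Fin l → ℤ),
      (∀ i u, (fun j => p i j u) = c i + A i u) ∧ (∀ i, A i ≠ 0) ∧
        ∀ i i', i ≠ i' → A i ≠ A i' := by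
  choose a c hp using hlin
  have hpA : ∀ i j u, p i j u = c i j + linearPart (a i) u j := fun i j u => by
    rw [hp, add_comm]
    rfl
  refine ⟨fun i => linearPart (a i), c, fun i u => funext fun j => hpA i j u, fun i h0 => ?_,
    fun i i' hne he => ?_⟩
  · obtain ⟨j, hj⟩ := hED.row_ne_zero i
    -- A vanishing linear part makes the entry constant, and the ED condition allows only the
    -- constant `0`. Equal linear parts are excluded in the same way through differences.
    have e : p i j = fun _ => c i j := funext fun u => by simp [hpA, h0]
    refine hED.not_const i j (c i j) (fun hc => hj ?_) e
    rw [e, hc]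
    rfl
  · obtain ⟨j, hj⟩ := hED.rows_distinct i i' hne
    have e : p i j - p i' j = fun _ => c i j - c i' j := funext fun u => by
      simp only [Pi.sub_apply, hpA, he]
      ring
    refine hED.not_differ_const i j i' j _ (fun hc => hj ?_) e
    rw [← sub_eq_zero, e, hc]
    rfl

end LinearPart

/-! ### Passage to the limsup and conclusion. -/

lemma limsup_le_ofReal_of_forall_eventually_le {u : ℕ → ℝ≥0∞} {c : ℝ}
    (h : ∀ ε > 0, ∀ᶠ N in atTop, u N ≤ ENNReal.ofReal (c + ε)) :
    limsup u atTop ≤ ENNReal.ofReal c := by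
  have hc : Tendsto (fun ε : ℝ => ENNReal.ofReal (c + ε)) (nhdsWithin 0 (Set.Ioi 0))
      (nhds (ENNReal.ofReal c)) := by
    have h1 : Continuous fun ε : ℝ => ENNReal.ofReal (c + ε) :=
      ENNReal.continuous_ofReal.comp (continuous_const.add continuous_id)
    simpa using (h1.tendsto 0).mono_left nhdsWithin_le_nhds
  refine ge_of_tendsto hc ?_
  filter_upwards [self_mem_nhdsWithin] with ε hε
  exact limsup_le_of_le (by isBoundedDefault) (h ε hε)

theorem propositionG {d l r : ℕ} (hr : 0 < r) (p : Fin r → Fin l → (Fin d → ℤ) → ℤ)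
    (hlin : ∀ i j, IsLinearFunction (p i j)) (hED : IsEDSet p) :
    ∃ C : ℝ, 0 < C ∧
      ∀ (X : Type u) [MeasurableSpace X] (μ : Measure X) [IsProbabilityMeasure μ]
        (T : Fin l → X ≃ᵐ X), IsFreelyGeneratedTotallyErgodic μ T →
      ∀ j : Fin l, HasHostKraMeasure (T j) μ (r + 1) →
      ∀ f : Fin r → X → ℝ, (∀ i, MemLp (f i) ∞ μ) → (∀ i, eLpNorm (f i) ∞ μ ≤ 1) →
      ∀ Φ : ℕ → Finset (Fin d → ℤ),
        IsAddFoelner (Fin d → ℤ) Measure.count atTop (fun N => (Φ N : Set (Fin d → ℤ))) →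
        limsup (fun N => eLpNorm (multiAverage T p f (Φ N)) 2 μ) atTop ≤
          ENNReal.ofReal (C * ⨅ i, hostKraSeminorm (T j) μ (r + 1) (f i)) := by
  obtain ⟨A, c, hpA, hA0, hA⟩ := hED.exists_linearPart hlin
  refine ⟨1, one_pos, fun X _ μ _ T hT j h f hf hf1 Φ hΦ => ?_⟩
  have : Nonempty (Fin r) := ⟨⟨0, hr⟩⟩
  obtain ⟨i₀, hi₀⟩ := exists_eq_ciInf_of_finite
    (f := fun i => hostKraSeminorm (T j) μ (r + 1) (f i))
  rw [one_mul, ← hi₀]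
  have hb : ∀ i, IsUnitBounded (f i) μ := fun i => ⟨(hf i).1, by
    have h1 : ∀ᵐ x ∂μ, ‖f i x‖ₑ ≤ eLpNormEssSup (f i) μ := ae_le_eLpNormEssSup
    filter_upwards [h1] with x hx
    have h2 : ‖f i x‖ₑ ≤ 1 := hx.trans (by simpa using hf1 i)
    rw [← ofReal_norm, ENNReal.ofReal_le_one] at h2
    exact h2⟩
  have hσ := fun i => hT.measurePreserving_genPow (c i)
  have hg : ∀ i, IsUnitBounded (fun x => f i (genPow T (c i) x)) μ := fun i => (hb i).comp (hσ i)
  have havg : ∀ N, multiAverage T p f (Φ N) = fun x => ((Φ N).card : ℝ)⁻¹ * ∑ u ∈ Φ N,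
      orbitProd T Finset.univ A (fun i x => f i (genPow T (c i) x)) u x := fun N => by
    ext x
    simp only [multiAverage, orbitProd, hpA, hT.genPow_add_apply]
  have hk : HasHostKraMeasure (T j) μ (Finset.univ : Finset (Fin r)).card := by
    rw [Finset.card_fin]
    exact h.of_succ
  refine limsup_le_ofReal_of_forall_eventually_le fun ε hε => ?_
  filter_upwards [eventually_norm_finsetAvg_orbitProd_le hT hΦ hk (fun i _ => hA0 i)
    (fun i _ i' _ => hA i i') (Finset.mem_univ i₀) hg hε] with N hN
  rw [havg, IsUnitBounded.eLpNorm_average _ fun u => IsUnitBounded.orbitProd hT hg _ _ u]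
  -- What remains is the passage from order `r` to `r + 1`: a `2^r`-th root is the `2^(r+1)`-th root
  -- of the square, to which Jensen's inequality applies.
  refine ENNReal.ofReal_le_ofReal (hN.trans (add_le_add_left ?_ ε))
  rw [Finset.card_fin, cubeIntegral_comp (hσ i₀) (hT.measurePreserving j)
    (hT.commute_genPow _ j) (hf i₀) h.of_succ]
  have h0 : 0 ≤ cubeIntegral (T j) μ r (f i₀) := by
    obtain ⟨k, rfl⟩ := Nat.exists_eq_succ_of_ne_zero hr.ne'
    exact cubeIntegral_succ_nonneg (hf i₀) h.of_succ
  calc cubeIntegral (T j) μ r (f i₀) ^ (1 / ((2 ^ r : ℕ) : ℝ))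
      = (cubeIntegral (T j) μ r (f i₀) ^ 2) ^ (1 / (2 : ℝ) ^ (r + 1)) := by
        rw [← Real.rpow_natCast, ← Real.rpow_mul h0]
        congr 1
        push_cast
        rw [pow_succ]
        field_simp
    _ ≤ cubeIntegral (T j) μ (r + 1) (f i₀) ^ (1 / (2 : ℝ) ^ (r + 1)) :=
        Real.rpow_le_rpow (sq_nonneg _) (cubeIntegral_sq_le (hf i₀) h) (by positivity)
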